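/- Let $k$ be an algebraically closed field of characteristic zero, let $r\ge 0$, and let $F_0,\ldots,F_r\in k[\mathbf x]=k[x_0,\ldots,x_r]$ be forms of the same degree $d$ generating an ideal $I$ of codimension (height) $\ge 2$. Let $\phi=(F_0:\cdots:F_r)\colon\mathbb P^r\dashrightarrow\mathbb P^r$ be the rational map they define. Let $\varphi$ be a graded presentation matrix of $I$ with respect to $F_0,\ldots,F_r$, that is, a matrix over $k[\mathbf x]$ with $r+1$ rows, the $j$-th column of which consists of forms of one degree $\delta_j\ge 0$, such that the sequence $$k[\mathbf x]^p\xrightarrow{\ \varphi\ }k[\mathbf x]^{r+1}\xrightarrow{(F_0,\ldots,F_r)}I\to 0$$ is exact. Let $\varphi_1$ be its linear part, i.e. the submatrix of the columns with $\delta_j=1$. Set $$\mathcal A=k[\mathbf x,\mathbf y]/I_1(\mathbf y\cdot\varphi_1),$$ where $\mathbf y=(y_0,\ldots,y_r)$ is a row of new variables and $I_1(\mathbf y\cdot\varphi_1)$ is the ideal generated by the entries of the product $\mathbf y\cdot\varphi_1$, bigraded by giving $x_i$ bidegree $(1,0)$ and $y_i$ bidegree $(0,1)$. Let $\mathcal R=\bigoplus_{n\ge0}I^nt^n\subseteq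 k[\mathbf x][t]$ be the Rees algebra of $I$, bigraded by giving $x_i$ bidegree $(1,0)$ and $F_it$ bidegree $(0,1)$; so $\mathcal R_{(a,b)}$ consists of the elements $g\,t^b$ with $g\in I^b$ a form of degree $a+bd$. Then: (i) The $k[\mathbf x]$-algebra map $\rho\colon\mathcal A\to\mathcal R$ with $\rho(y_i)=F_it$ is well defined and surjective, and it is bigraded: $\rho(\mathcal A_{(a,b)})=\mathcal R_{(a,b)}$ for all $a,b\ge 0$. (ii) If the Jacobian determinant $\det(\partial F_i/\partial x_j)$ is nonzero and $\ker\rho$ is a minimal prime of $\mathcal A$, then $\phi$ is a Cremona map. (iii) If the Jacobian determinant $\det(\partial F_i/\partial x_j)$ is nonzero and $\varphi_1$ has maximal rank $r$, then $\phi$ is a Cremona map. Here $\phi$ is a Cremona map if it is birational, i.e. if there is a rational map $\psi=(G_0:\cdots:G_r)\colon\mathbb P^r\dashrightarrow\mathbb P^r$, given by forms $G_i$ of one degree, not all zero, such that both composites $\psi\circ\phi$ and $\phi\circ\psi$ are defined (the composed tuples of forms are not identically zero) and equal to the identity as rational maps. -/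

import Mathlib

open scoped Matrix

noncomputable section

namespace PolyMap

/-! ### Rational maps of projective space given by forms -/

/-- A tuple of polynomials defines a rational map of projective `r`-space to itself if its members
are forms of one and the same degree, not all zero. -/
def IsRationalMap {k : Type*} [Field k] {r : ℕ}
    (F : Fin (r + 1) → MvPolynomial (Fin (r + 1)) k) : Prop :=
  (∃ d : ℕ, ∀ i, (F i).IsHomogeneous d) ∧ F ≠ 0

/-- Two tuples of forms define the same rational map if they are proportional. -/
def SameRationalMap {k : Type*} [Field k] {r : ℕ}
    (F G : Fin (r + 1) → MvPolynomial (Fin (r + 1)) k) : Prop :=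
  ∀ i j, F i * G j = F j * G i

/-- The tuple `G_i (F_0, …, F_r)`. It defines the composite rational map `G ∘ F`, provided that it
is not identically zero. -/
def comp {k : Type*} [Field k] {r : ℕ}
    (G F : Fin (r + 1) → MvPolynomial (Fin (r + 1)) k) :
    Fin (r + 1) → MvPolynomial (Fin (r + 1)) k :=
  fun i => MvPolynomial.aeval F (G i)

/-- The rational map `(F_0 : ⋯ : F_r)` of projective `r`-space is a Cremona map (birational
transformation): there is a rational map `(G_0 : ⋯ : G_r)` such that both composites are defined
and are equal, as rational maps, to the identity `(x_0 : ⋯ : x_r)`. -/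
def IsCremona {k : Type*} [Field k] {r : ℕ}
    (F : Fin (r + 1) → MvPolynomial (Fin (r + 1)) k) : Prop :=
  IsRationalMap F ∧ ∃ G : Fin (r + 1) → MvPolynomial (Fin (r + 1)) k, IsRationalMap G ∧
    (IsRationalMap (comp G F) ∧ SameRationalMap (comp G F) MvPolynomial.X) ∧
    (IsRationalMap (comp F G) ∧ SameRationalMap (comp F G) MvPolynomial.X)

/-- The Jacobian matrix `(∂F_i / ∂x_j)`. -/
def jacobian {k : Type*} [Field k] {r : ℕ}
    (F : Fin (r + 1) → MvPolynomial (Fin (r + 1)) k) :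
    Matrix (Fin (r + 1)) (Fin (r + 1)) (MvPolynomial (Fin (r + 1)) k) :=
  Matrix.of fun i j => MvPolynomial.pderiv j (F i)

/-- The ideal `I ⊆ k[x]` generated by `F_0, …, F_r`. -/
def baseIdeal {k : Type*} [Field k] {r : ℕ}
    (F : Fin (r + 1) → MvPolynomial (Fin (r + 1)) k) :
    Ideal (MvPolynomial (Fin (r + 1)) k) :=
  Ideal.span (Set.range F)

/-! ### Graded presentation matrices and their linear part -/

/-- `φ` is a graded presentation matrix of the ideal generated by the forms `F_0, …, F_r`: the
`j`-th column consists of forms of degree `deg j`, and the sequence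
`k[x]^p → k[x]^(r+1) → I → 0` given by `φ` and by `(F_0, …, F_r)` is exact. -/
structure IsGradedPresentation {k : Type*} [Field k] {r p : ℕ}
    (F : Fin (r + 1) → MvPolynomial (Fin (r + 1)) k)
    (φ : Matrix (Fin (r + 1)) (Fin p) (MvPolynomial (Fin (r + 1)) k))
    (deg : Fin p → ℕ) : Prop where
  isHomogeneous : ∀ i j, (φ i j).IsHomogeneous (deg j)
  exact : Function.Exact φ.mulVecLin
    (Fintype.linearCombination (MvPolynomial (Fin (r + 1)) k) F)

/-- The linear part `φ₁` of `φ`: the submatrix of the columns of degree one. -/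
def linearPart {k : Type*} [Field k] {r p : ℕ}
    (φ : Matrix (Fin (r + 1)) (Fin p) (MvPolynomial (Fin (r + 1)) k)) (deg : Fin p → ℕ) :
    Matrix (Fin (r + 1)) {j : Fin p // deg j = 1} (MvPolynomial (Fin (r + 1)) k) :=
  φ.submatrix id Subtype.val

theorem IsGradedPresentation.vecMul_linearPart {k : Type*} [Field k] {r p : ℕ}
    {F : Fin (r + 1) → MvPolynomial (Fin (r + 1)) k}
    {φ : Matrix (Fin (r + 1)) (Fin p) (MvPolynomial (Fin (r + 1)) k)} {deg : Fin p → ℕ}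
    (h : IsGradedPresentation F φ deg) : F ᵥ* linearPart φ deg = 0 := by
  funext j
  have h1 := (h.exact (φ.mulVecLin (Pi.single j.1 1))).2 ⟨_, rfl⟩
  simpa [Fintype.linearCombination_apply, linearPart, Matrix.vecMul, dotProduct, mul_comm]
    using h1

/-! ### The incidence algebra -/

/-- The ideal `I_1(y · M)` of `k[x, y] = k[x][y]` generated by the entries of the product of the
row `(y_0, …, y_r)` and the matrix `M`. -/
def incidenceIdeal {k : Type*} [Field k] {r : ℕ} {ι : Type*}
    (M : Matrix (Fin (r + 1)) ι (MvPolynomial (Fin (r + 1)) k)) :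
    Ideal (MvPolynomial (Fin (r + 1)) (MvPolynomial (Fin (r + 1)) k)) :=
  Ideal.span (Set.range (MvPolynomial.X ᵥ* M.map MvPolynomial.C))

/-- The incidence algebra `k[x, y] / I_1(y · M)`. -/
abbrev IncidenceAlgebra {k : Type*} [Field k] {r : ℕ} {ι : Type*}
    (M : Matrix (Fin (r + 1)) ι (MvPolynomial (Fin (r + 1)) k)) : Type _ :=
  MvPolynomial (Fin (r + 1)) (MvPolynomial (Fin (r + 1)) k) ⧸ incidenceIdeal M

/-- The bihomogeneous polynomials of bidegree `(a, b)` in `k[x, y] = k[x][y]`: forms of degree `b`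
in `y` whose coefficients are forms of degree `a` in `x`. -/
def bihomogeneous (k : Type*) [Field k] (r a b : ℕ) :
    Submodule k (MvPolynomial (Fin (r + 1)) (MvPolynomial (Fin (r + 1)) k)) where
  carrier := {P | P.IsHomogeneous b ∧ ∀ m, (P.coeff m).IsHomogeneous a}
  zero_mem' := ⟨MvPolynomial.isHomogeneous_zero _ _ _, fun m => by
    simpa using MvPolynomial.isHomogeneous_zero _ _ _⟩
  add_mem' := fun hP hQ => ⟨hP.1.add hQ.1, fun m => by
    simpa using (hP.2 m).add (hQ.2 m)⟩
  smul_mem' := fun c P hP => by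
    refine ⟨fun m hm => hP.1 (d := m) fun h0 => hm ?_, fun m => ?_⟩
    · simp [MvPolynomial.coeff_smul, h0]
    · rw [MvPolynomial.coeff_smul]
      exact (MvPolynomial.homogeneousSubmodule (Fin (r + 1)) k a).smul_mem c (hP.2 m)

/-- The component of bidegree `(a, b)` of the incidence algebra. -/
def incidencePiece {k : Type*} [Field k] {r : ℕ} {ι : Type*}
    (M : Matrix (Fin (r + 1)) ι (MvPolynomial (Fin (r + 1)) k)) (a b : ℕ) :
    Submodule k (IncidenceAlgebra M) :=
  (bihomogeneous k r a b).map (Ideal.Quotient.mkₐ k (incidenceIdeal M)).toLinearMap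

/-! ### The Rees algebra and the structural map -/

/-- The component of bidegree `(a, b)` of the Rees algebra `⊕ I^n t^n` of an ideal generated by
forms of degree `d`, where `x_i` has bidegree `(1, 0)` and `F_i t` has bidegree `(0, 1)`: the
elements `g t^b` with `g ∈ I^b` a form of degree `a + b d`. -/
def reesPiece {k : Type*} [Field k] {r : ℕ}
    (I : Ideal (MvPolynomial (Fin (r + 1)) k)) (d a b : ℕ) :
    Submodule k (reesAlgebra I) :=
  ((MvPolynomial.homogeneousSubmodule (Fin (r + 1)) k (a + b * d)).map
    ((Polynomial.monomial (R := MvPolynomial (Fin (r + 1)) k) b).restrictScalars k)).comap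
    ((reesAlgebra I).val.toLinearMap.restrictScalars k)

/-- The element `F_i t` of the Rees algebra of the ideal generated by `F_0, …, F_r`. -/
def reesGen {k : Type*} [Field k] {r : ℕ}
    (F : Fin (r + 1) → MvPolynomial (Fin (r + 1)) k) (i : Fin (r + 1)) :
    reesAlgebra (baseIdeal F) :=
  ⟨Polynomial.monomial 1 (F i), by
    rw [reesAlgebra.monomial_mem, pow_one]
    exact Ideal.subset_span ⟨i, rfl⟩⟩

/-- The `k[x]`-algebra map `k[x, y] → Rees(I)` that sends `y_i` to `F_i t`. -/
def toRees {k : Type*} [Field k] {r : ℕ}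
    (F : Fin (r + 1) → MvPolynomial (Fin (r + 1)) k) :
    MvPolynomial (Fin (r + 1)) (MvPolynomial (Fin (r + 1)) k)
      →ₐ[MvPolynomial (Fin (r + 1)) k] reesAlgebra (baseIdeal F) :=
  MvPolynomial.aeval (reesGen F)

theorem incidenceIdeal_le_ker {k : Type*} [Field k] {r : ℕ} {ι : Type*}
    {F : Fin (r + 1) → MvPolynomial (Fin (r + 1)) k}
    {M : Matrix (Fin (r + 1)) ι (MvPolynomial (Fin (r + 1)) k)} (h : F ᵥ* M = 0) :
    incidenceIdeal M ≤ RingHom.ker (toRees F) := by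
  refine Ideal.span_le.2 ?_
  rintro _ ⟨j, rfl⟩
  have hj : ∑ i, F i * M i j = 0 := by simpa [Matrix.vecMul, dotProduct] using congrFun h j
  change toRees F _ = 0
  apply Subtype.ext
  simp only [Matrix.vecMul, dotProduct, Matrix.map_apply, map_sum, map_mul, toRees,
    MvPolynomial.aeval_X, MvPolynomial.aeval_C]
  have h2 : ∀ i, ((reesGen F i * algebraMap _ (reesAlgebra (baseIdeal F)) (M i j) :
      reesAlgebra (baseIdeal F)) : Polynomial (MvPolynomial (Fin (r + 1)) k)) =
      Polynomial.monomial 1 (F i * M i j) := by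
    intro i
    change Polynomial.monomial 1 (F i) * Polynomial.C (M i j) = _
    rw [Polynomial.monomial_mul_C]
  rw [AddSubmonoidClass.coe_finsetSum, Finset.sum_congr rfl fun i _ => h2 i, ← map_sum, hj]
  simp

/-- The structural map `ρ : k[x, y] / I_1(y · φ₁) → Rees(I)` induced by `y_i ↦ F_i t`. -/
def incidenceToRees {k : Type*} [Field k] {r p : ℕ}
    {F : Fin (r + 1) → MvPolynomial (Fin (r + 1)) k}
    {φ : Matrix (Fin (r + 1)) (Fin p) (MvPolynomial (Fin (r + 1)) k)} {deg : Fin p → ℕ}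
    (h : IsGradedPresentation F φ deg) :
    IncidenceAlgebra (linearPart φ deg)
      →ₐ[MvPolynomial (Fin (r + 1)) k] reesAlgebra (baseIdeal F) :=
  Ideal.Quotient.liftₐ _ (toRees F) fun _ ha => incidenceIdeal_le_ker h.vecMul_linearPart ha

end PolyMap

end

/-!
The statement on the Rees algebra is the fact that `I ^ b` consists of the values at `F` of the
forms of degree `b` in `y`, together with the remark that the coefficients of such a form may be
replaced by their homogeneous components of the right degree.

For birationality, put `M = φ₁`. Each of the two hypotheses implies that `F` is, up to
proportionality, the only row relation of `M`. When `M` has rank `r` this is a count of ranks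
(`sameRationalMap_of_rank_eq`). When `ker ρ` is a minimal prime, each relation `w` defines the map
`y_i ↦ F_i t + w_i s` from the incidence algebra to a polynomial ring over `k[x]`; its kernel is a
prime inside `ker ρ`, so the two agree, and the vanishing of the image of `F_j y_i - F_i y_j` shows
that `w` is proportional to `F` (`sameRationalMap_of_ker_mem_minimalPrimes`).

Write `y · M(x) = x · ψ(y)`, where `ψ` is the Jacobian dual of `M`. Differentiating `F · M = 0`
gives `ψ(F) = -Jᵀ M` with `J` the Jacobian matrix of `F`. As `J` is injective and `J x = d F`, the
row relations of `ψ(F)` are the multiples of `x`. Since `x · ψ(F) = 0` and the `F_i` are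
algebraically independent, the rows of `ψ(y)` are linearly dependent, and a homogeneous relation
`G(y)` among them satisfies `G(F) · ψ(F) = 0`. So `G(F)` is a nonzero multiple of `x`, that is, `G ∘
F` is the identity; `F ∘ G` is the identity because `F` is dominant (`isCremona_of_vecMul_eq_zero`).
-/

namespace PolyMap

open MvPolynomial

/-! ### Homogeneous components -/

theorem sum_eq_of_mem_support {σ R : Type*} [Fintype σ] [CommSemiring R] {P : MvPolynomial σ R}
    {b : ℕ} (hP : P.IsHomogeneous b) {m : σ →₀ ℕ} (hm : m ∈ P.support) : ∑ j, m j = b := by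
  rw [← Finsupp.degree_eq_sum]
  by_contra hc
  exact mem_support_iff.1 hm (hP.coeff_eq_zero hc)

/-- Multiplication by a form of degree `c` shifts homogeneous components by `c`. -/
theorem homogeneousComponent_mul_of_isHomogeneous {σ R : Type*} [CommSemiring R]
    (P : MvPolynomial σ R) {Q : MvPolynomial σ R} (a : ℕ) {c : ℕ} (hQ : Q.IsHomogeneous c) :
    homogeneousComponent (a + c) (P * Q) = homogeneousComponent a P * Q := by
  conv_lhs => rw [← sum_homogeneousComponent P, Finset.sum_mul, map_sum]
  have h : ∀ n, homogeneousComponent (a + c) (homogeneousComponent n P * Q) =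
      if n = a then homogeneousComponent a P * Q else 0 := by
    intro n
    rw [homogeneousComponent_of_mem ((homogeneousComponent_isHomogeneous n P).mul hQ)]
    by_cases hn : n = a
    · simp [hn]
    · rw [if_neg (by omega), if_neg hn]
  simp only [h, Finset.sum_ite_eq', Finset.mem_range]
  split_ifs with ha
  · rfl
  · rw [homogeneousComponent_eq_zero _ _ (by omega), zero_mul]

/-! ### The Jacobian criterion -/

/-- The chain rule for the substitution of a tuple of polynomials. -/
theorem pderiv_aeval {σ τ R : Type*} [Fintype σ] [CommRing R]
    (F : σ → MvPolynomial τ R) (P : MvPolynomial σ R) (j : τ) :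
    pderiv j (aeval F P) = ∑ i, aeval F (pderiv i P) * pderiv j (F i) := by
  classical
  induction P using MvPolynomial.induction_on with
  | C a => simp [algebraMap_eq]
  | add P Q hP hQ => simp only [map_add, hP, hQ, add_mul, Finset.sum_add_distrib]
  | mul_X P i hP =>
    simp only [map_mul, aeval_X, pderiv_mul, hP, map_add, add_mul, Finset.sum_add_distrib,
      pderiv_X, Finset.sum_mul]
    congr 1
    · exact Finset.sum_congr rfl fun _ _ => by ring
    · rw [Finset.sum_eq_single i (by
        intro b _ hb
        simp [hb.symm]) (by simp)]
      simp

theorem totalDegree_pderiv_le {σ R : Type*} [CommRing R] (P : MvPolynomial σ R) (i : σ) :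
    (pderiv i P).totalDegree ≤ P.totalDegree - 1 := by
  refine Finset.sup_le fun m hm => ?_
  have h1 : m + Finsupp.single i 1 ∈ P.support := by
    rw [mem_support_iff] at hm ⊢
    intro h0
    exact hm (by rw [coeff_pderiv, h0, zero_mul])
  have h2 := le_totalDegree h1
  rw [Finsupp.sum_add_index' (by simp) (by simp), Finsupp.sum_single_index rfl] at h2
  omega

theorem eq_C_of_pderiv_eq_zero {σ R : Type*} [CommRing R] [IsDomain R] [CharZero R]
    {P : MvPolynomial σ R} (h : ∀ i, pderiv i P = 0) : P = C (coeff 0 P) := by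
  classical
  ext m
  rw [coeff_C]
  split_ifs with hm
  · rw [hm]
  obtain ⟨i, hi⟩ : ∃ i, m i ≠ 0 := by
    by_contra! hc
    exact hm (Finsupp.ext fun i => (hc i).symm)
  have h1 := coeff_pderiv (i := i) P (m - Finsupp.single i 1)
  have h2 : m - Finsupp.single i 1 + Finsupp.single i 1 = m :=
    tsub_add_cancel_of_le (Finsupp.single_le_iff.2 (Nat.one_le_iff_ne_zero.2 hi))
  rw [h i, coeff_zero, h2] at h1
  refine (mul_eq_zero.1 h1.symm).resolve_right ?_
  exact Nat.cast_add_one_ne_zero _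

/-- The Jacobian criterion, in the direction that a nonvanishing Jacobian determinant forces
algebraic independence: the gradient of a relation `P`, evaluated at `F`, is killed by the Jacobian
matrix, so that the partial derivatives of `P` are relations of smaller degree, and zero by
induction. -/
theorem aeval_injective_of_det_jacobian_ne_zero {k : Type*} [Field k] [CharZero k] {r : ℕ}
    {F : Fin (r + 1) → MvPolynomial (Fin (r + 1)) k} (hJ : (jacobian F).det ≠ 0) :
    Function.Injective (aeval F : MvPolynomial (Fin (r + 1)) k →ₐ[k] _) := by
  have key : ∀ (n : ℕ) (P : MvPolynomial (Fin (r + 1)) k), P.totalDegree ≤ n →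
      aeval F P = 0 → P = 0 := by
    intro n
    induction n with
    | zero =>
      intro P hn hP
      rw [totalDegree_eq_zero_iff_eq_C.1 (Nat.le_zero.1 hn)] at hP ⊢
      simpa [algebraMap_eq] using hP
    | succ n ih =>
      intro P hn hP
      have h0 : (fun i => aeval F (pderiv i P)) = 0 := by
        refine Matrix.eq_zero_of_vecMul_eq_zero hJ (funext fun j => ?_)
        have := pderiv_aeval F P j
        rw [hP, map_zero] at this
        exact this.symm
      have h1 : ∀ i, pderiv i P = 0 := fun i =>
        ih _ ((totalDegree_pderiv_le P i).trans (by omega)) (congrFun h0 i)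
      rw [eq_C_of_pderiv_eq_zero h1] at hP ⊢
      simpa [algebraMap_eq] using hP
  exact (injective_iff_map_eq_zero _).2 fun P => key _ P le_rfl

theorem ne_zero_of_det_jacobian_ne_zero {k : Type*} [Field k] {r : ℕ}
    {F : Fin (r + 1) → MvPolynomial (Fin (r + 1)) k} (hJ : (jacobian F).det ≠ 0) : F ≠ 0 := by
  rintro rfl
  apply hJ
  have : jacobian (0 : Fin (r + 1) → MvPolynomial (Fin (r + 1)) k) = 0 := by
    ext1 i j
    simp [jacobian]
  rw [this, Matrix.det_zero]

/-- Euler's identity for all the forms `F_i` at once. -/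
theorem jacobian_mulVec_X {k : Type*} [Field k] {r d : ℕ}
    {F : Fin (r + 1) → MvPolynomial (Fin (r + 1)) k} (hF : ∀ i, (F i).IsHomogeneous d) :
    jacobian F *ᵥ X = d • F := by
  funext i
  simpa [jacobian, Matrix.mulVec, dotProduct, mul_comm] using (hF i).sum_X_mul_pderiv

/-! ### The Jacobian dual of a matrix of linear forms -/

/-- The Jacobian dual of a matrix `M` of linear forms: the matrix `ψ` of linear forms in `y` with
`y · M(x) = x · ψ(y)`. The variables `y` are again called `X`, and the coefficient of `x_l` in
`M i j` is written as the constant `∂ (M i j) / ∂ x_l`. -/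
noncomputable def jacobianDual {k : Type*} [Field k] {r : ℕ} {ι : Type*}
    (M : Matrix (Fin (r + 1)) ι (MvPolynomial (Fin (r + 1)) k)) :
    Matrix (Fin (r + 1)) ι (MvPolynomial (Fin (r + 1)) k) :=
  Matrix.of fun l j => ∑ i, X i * pderiv l (M i j)

theorem jacobianDual_isHomogeneous {k : Type*} [Field k] {r : ℕ} {ι : Type*}
    {M : Matrix (Fin (r + 1)) ι (MvPolynomial (Fin (r + 1)) k)}
    (hM : ∀ i j, (M i j).IsHomogeneous 1) (l : Fin (r + 1)) (j : ι) :
    (jacobianDual M l j).IsHomogeneous 1 :=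
  IsHomogeneous.sum Finset.univ (fun i => X i * pderiv l (M i j)) 1 fun i _ =>
    (isHomogeneous_X k i).mul (hM i j).pderiv

/-- Differentiating the relations `F · M = 0` expresses the Jacobian dual at `y = F` through the
Jacobian matrix of `F`. -/
theorem aeval_jacobianDual {k : Type*} [Field k] {r : ℕ} {ι : Type*}
    {F : Fin (r + 1) → MvPolynomial (Fin (r + 1)) k}
    {M : Matrix (Fin (r + 1)) ι (MvPolynomial (Fin (r + 1)) k)}
    (hM : ∀ i j, (M i j).IsHomogeneous 1) (hFM : F ᵥ* M = 0) :
    (jacobianDual M).map (aeval F) = -((jacobian F)ᵀ * M) := by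
  ext1 l j
  have h1 : ∑ i, F i * M i j = 0 := congrFun hFM j
  have h2 := congrArg (pderiv l) h1
  simp only [map_sum, pderiv_mul, Finset.sum_add_distrib, map_zero] at h2
  -- the entries of `M` are linear forms, so their derivatives are constants
  have h3 : ∀ i, aeval F (pderiv l (M i j)) = pderiv l (M i j) := by
    intro i
    have : (pderiv l (M i j)).IsHomogeneous 0 := (hM i j).pderiv
    rw [totalDegree_eq_zero_iff_eq_C.1 ((totalDegree_zero_iff_isHomogeneous _).2 this)]
    simp [algebraMap_eq]
  simp only [jacobianDual, Matrix.map_apply, Matrix.of_apply, map_sum, map_mul, aeval_X, h3,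
    Matrix.neg_apply, Matrix.mul_apply, Matrix.transpose_apply, jacobian]
  exact eq_neg_of_add_eq_zero_right h2

/-- If the row relations of `M` are the multiples of `F`, then those of the Jacobian dual at `y = F`
are the multiples of `x`: the Jacobian matrix carries a relation `v` of the latter kind to one of
the former kind, it carries `x` to `d • F`, and it is injective. -/
theorem sameRationalMap_X_of_vecMul_jacobianDual_eq_zero {k : Type*} [Field k]
    [CharZero k] {r d : ℕ} {ι : Type*} {F : Fin (r + 1) → MvPolynomial (Fin (r + 1)) k}
    (hF : ∀ i, (F i).IsHomogeneous d) (hJ : (jacobian F).det ≠ 0)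
    {M : Matrix (Fin (r + 1)) ι (MvPolynomial (Fin (r + 1)) k)}
    (hM : ∀ i j, (M i j).IsHomogeneous 1) (hFM : F ᵥ* M = 0)
    (hker : ∀ w, w ᵥ* M = 0 → SameRationalMap w F)
    {v : Fin (r + 1) → MvPolynomial (Fin (r + 1)) k}
    (hv : v ᵥ* (jacobianDual M).map (aeval F) = 0) : SameRationalMap v X := by
  obtain ⟨j, hj⟩ := Function.ne_iff.1 (ne_zero_of_det_jacobian_ne_zero hJ)
  rw [aeval_jacobianDual hM hFM, Matrix.vecMul_neg, neg_eq_zero, ← Matrix.vecMul_vecMul,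
    Matrix.vecMul_transpose] at hv
  have h1 := hker _ hv
  set w := jacobian F *ᵥ v with hw
  have h2 : (d * F j) • v - w j • (X : Fin (r + 1) → MvPolynomial (Fin (r + 1)) k) = 0 := by
    refine Matrix.eq_zero_of_mulVec_eq_zero hJ ?_
    rw [Matrix.mulVec_sub, Matrix.mulVec_smul, Matrix.mulVec_smul, jacobian_mulVec_X hF, ← hw]
    funext i
    simp only [Pi.sub_apply, Pi.smul_apply, smul_eq_mul, nsmul_eq_mul, Pi.zero_apply, Pi.mul_apply,
      Pi.natCast_apply]
    linear_combination (d : MvPolynomial (Fin (r + 1)) k) * h1 i j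
  -- for `d = 0` the vector `x` would lie in the kernel of the Jacobian matrix
  have hd : d ≠ 0 := by
    rintro rfl
    have h3 := Matrix.eq_zero_of_mulVec_eq_zero hJ (v := X)
      (by rw [jacobian_mulVec_X hF, zero_smul])
    exact X_ne_zero _ (congrFun h3 j)
  have hdF : (d : MvPolynomial (Fin (r + 1)) k) * F j ≠ 0 :=
    mul_ne_zero (by exact_mod_cast hd) hj
  intro i l
  apply mul_left_cancel₀ hdF
  have hi := congrFun h2 i
  have hl := congrFun h2 l
  simp only [Pi.sub_apply, Pi.smul_apply, smul_eq_mul, Pi.zero_apply] at hi hl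
  linear_combination X l * hi - X i * hl

/-! ### Construction of the inverse map -/

/-- Linear dependence of the rows of a matrix descends along an injective ring homomorphism into a
domain. -/
theorem exists_vecMul_eq_zero_of_map {A B ι : Type*} [Finite ι] [CommRing A] [CommRing B]
    [IsDomain B] {n : ℕ} (f : A →+* B) (hf : Function.Injective f) (N : Matrix (Fin n) ι A)
    {v : Fin n → B} (hv0 : v ≠ 0) (hv : v ᵥ* N.map f = 0) :
    ∃ g : Fin n → A, g ≠ 0 ∧ g ᵥ* N = 0 := by
  let _ := f.toAlgebra
  have : FaithfulSMul A B := (faithfulSMul_iff_algebraMap_injective A B).2 hf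
  -- linear independence over `A` would persist over `B`
  have h : ¬ LinearIndependent A N.row := by
    rw [← linearIndependent_algebraMap_comp_iff (S := B), Fintype.linearIndependent_iff]
    intro hc
    refine hv0 (funext fun i => hc v ?_ i)
    funext j
    simpa [Matrix.vecMul, dotProduct, RingHom.algebraMap_toAlgebra] using congrFun hv j
  rw [Fintype.not_linearIndependent_iff] at h
  obtain ⟨g, hg, i, hi⟩ := h
  refine ⟨g, fun h0 => hi (congrFun h0 i), funext fun j => ?_⟩
  simpa [Matrix.vecMul, dotProduct] using congrFun hg j

/-- A nonzero row relation of a matrix of forms of one degree has a nonzero homogeneous component,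
which is again a row relation. -/
theorem exists_homogeneous_vecMul_eq_zero {σ R ι : Type*} [CommRing R] {n : ℕ}
    {N : Matrix (Fin n) ι (MvPolynomial σ R)} {c : ℕ} (hN : ∀ i j, (N i j).IsHomogeneous c)
    {g : Fin n → MvPolynomial σ R} (hg0 : g ≠ 0) (hg : g ᵥ* N = 0) :
    ∃ (e : ℕ) (G : Fin n → MvPolynomial σ R),
      (∀ i, (G i).IsHomogeneous e) ∧ G ≠ 0 ∧ G ᵥ* N = 0 := by
  obtain ⟨i, hi⟩ := Function.ne_iff.1 hg0
  obtain ⟨e, he⟩ : ∃ e, homogeneousComponent e (g i) ≠ 0 := by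
    by_contra! hc
    exact hi (by rw [← sum_homogeneousComponent (g i)]; simp [hc])
  refine ⟨e, fun i => homogeneousComponent e (g i), fun i => homogeneousComponent_isHomogeneous _ _,
    fun h0 => he (congrFun h0 i), funext fun j => ?_⟩
  have h1 : ∑ i, g i * N i j = 0 := congrFun hg j
  have h2 := congrArg (homogeneousComponent (e + c)) h1
  rw [map_sum, map_zero] at h2
  change ∑ i, homogeneousComponent e (g i) * N i j = 0
  rw [← h2]
  exact Finset.sum_congr rfl fun i _ =>
    (homogeneousComponent_mul_of_isHomogeneous _ e (hN i j)).symm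

/-- If `V` is proportional to `x`, then `F(V)` is proportional to `F`, with the `d`-th power of the
factor `V_l / x_l`. -/
theorem SameRationalMap.comp_left {k : Type*} [Field k] {r d : ℕ}
    {F V : Fin (r + 1) → MvPolynomial (Fin (r + 1)) k} (hF : ∀ i, (F i).IsHomogeneous d)
    (hV : SameRationalMap V X) (l i : Fin (r + 1)) :
    X l ^ d * aeval V (F i) = V l ^ d * F i := by
  have hs : ∀ (c : MvPolynomial (Fin (r + 1)) k) (W : Fin (r + 1) → MvPolynomial (Fin (r + 1)) k),
      aeval (fun j => c * W j) (F i) = c ^ d * aeval W (F i) := by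
    intro c W
    rw [aeval_def, eval₂_eq', aeval_def, eval₂_eq', Finset.mul_sum]
    refine Finset.sum_congr rfl fun m hm => ?_
    have hdeg : ∑ j, m j = d := sum_eq_of_mem_support (hF i) hm
    simp only [mul_pow, Finset.prod_mul_distrib, Finset.prod_pow_eq_pow_sum, hdeg]
    ring
  have h1 : (fun j => X l * V j) = fun j => V l * X j :=
    funext fun j => by rw [mul_comm]; exact hV j l
  rw [← hs, h1, hs, aeval_X_left_apply]

/-- A left inverse `G` of a dominant rational map `F` is a two-sided inverse: since `aeval F` is
injective, the identity `F ∘ G = id` may be checked after substituting `F`. -/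
theorem isCremona_of_aeval_injective {k : Type*} [Field k] {r d e : ℕ}
    {F G : Fin (r + 1) → MvPolynomial (Fin (r + 1)) k} (hF : ∀ i, (F i).IsHomogeneous d)
    (hF0 : F ≠ 0) (hinj : Function.Injective (aeval F : MvPolynomial (Fin (r + 1)) k →ₐ[k] _))
    (hG : ∀ i, (G i).IsHomogeneous e) (hG0 : G ≠ 0) (hGF : SameRationalMap (comp G F) X) :
    IsCremona F := by
  obtain ⟨i, hi⟩ := Function.ne_iff.1 hF0
  obtain ⟨l, hl⟩ := Function.ne_iff.1 hG0
  have hl' : comp G F l ≠ 0 := fun h => hl (hinj (by rw [Pi.zero_apply, map_zero]; exact h))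
  have hc : ∀ i, aeval F (comp F G i) = aeval (comp G F) (F i) := fun i => by
    change (aeval F) ((aeval G) (F i)) = _
    rw [comp_aeval_apply]
    rfl
  have hX : (X l : MvPolynomial (Fin (r + 1)) k) ^ d ≠ 0 := pow_ne_zero _ (X_ne_zero l)
  have hFG := hGF.comp_left hF l
  refine ⟨⟨⟨d, hF⟩, hF0⟩, G, ⟨⟨e, hG⟩, hG0⟩,
    ⟨⟨⟨d * e, fun i => (hG i).aeval F hF⟩, fun h => hl' (congrFun h l)⟩, hGF⟩,
    ⟨⟨e * d, fun i => (hF i).aeval G hG⟩, fun h => ?_⟩, fun i j => hinj ?_⟩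
  · refine mul_ne_zero (pow_ne_zero d hl') hi ?_
    rw [← hFG, ← hc, h, Pi.zero_apply, map_zero, mul_zero]
  · rw [map_mul, map_mul, aeval_X, aeval_X, hc, hc]
    apply mul_left_cancel₀ hX
    linear_combination F j * hFG i - F i * hFG j

/-- If `F` has nonvanishing Jacobian determinant and is, up to proportionality, the only row
relation of a matrix `M` of linear forms, then `F` is a Cremona map. The inverse is a homogeneous
row relation of the Jacobian dual of `M`. -/
theorem isCremona_of_vecMul_eq_zero {k : Type*} [Field k] [CharZero k] {r d : ℕ} {ι : Type*}
    [Finite ι] {F : Fin (r + 1) → MvPolynomial (Fin (r + 1)) k} (hF : ∀ i, (F i).IsHomogeneous d)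
    (hJ : (jacobian F).det ≠ 0)
    {M : Matrix (Fin (r + 1)) ι (MvPolynomial (Fin (r + 1)) k)}
    (hM : ∀ i j, (M i j).IsHomogeneous 1) (hFM : F ᵥ* M = 0)
    (hker : ∀ w, w ᵥ* M = 0 → SameRationalMap w F) : IsCremona F := by
  have hinj := aeval_injective_of_det_jacobian_ne_zero hJ
  have hX : X ᵥ* (jacobianDual M).map (aeval F) = 0 := by
    rw [aeval_jacobianDual hM hFM, Matrix.vecMul_neg, neg_eq_zero, ← Matrix.vecMul_vecMul,
      Matrix.vecMul_transpose, jacobian_mulVec_X hF, Matrix.smul_vecMul, hFM, smul_zero]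
  have hX0 : (X : Fin (r + 1) → MvPolynomial (Fin (r + 1)) k) ≠ 0 :=
    fun h => X_ne_zero 0 (congrFun h 0)
  obtain ⟨g, hg0, hg⟩ := exists_vecMul_eq_zero_of_map
    (aeval F : MvPolynomial (Fin (r + 1)) k →ₐ[k] _).toRingHom hinj (jacobianDual M) hX0 hX
  obtain ⟨e, G, hG, hG0, hGM⟩ :=
    exists_homogeneous_vecMul_eq_zero (jacobianDual_isHomogeneous hM) hg0 hg
  refine isCremona_of_aeval_injective hF (ne_zero_of_det_jacobian_ne_zero hJ) hinj hG hG0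
    (sameRationalMap_X_of_vecMul_jacobianDual_eq_zero hF hJ hM hFM hker ?_)
  funext j
  have := congrArg (aeval F) (congrFun hGM j)
  simpa [Matrix.vecMul, dotProduct, comp] using this

/-! ### The Rees algebra -/

theorem coe_toRees {k : Type*} [Field k] {r : ℕ} (F : Fin (r + 1) → MvPolynomial (Fin (r + 1)) k)
    (P : MvPolynomial (Fin (r + 1)) (MvPolynomial (Fin (r + 1)) k)) :
    (toRees F P : Polynomial (MvPolynomial (Fin (r + 1)) k)) =
      aeval (fun i => Polynomial.monomial 1 (F i)) P := by
  change (reesAlgebra (baseIdeal F)).val (aeval (reesGen F) P) = _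
  rw [comp_aeval_apply]
  rfl

theorem coe_toRees_of_isHomogeneous {k : Type*} [Field k] {r b : ℕ}
    (F : Fin (r + 1) → MvPolynomial (Fin (r + 1)) k)
    {P : MvPolynomial (Fin (r + 1)) (MvPolynomial (Fin (r + 1)) k)} (hP : P.IsHomogeneous b) :
    (toRees F P : Polynomial (MvPolynomial (Fin (r + 1)) k)) =
      Polynomial.monomial b (eval F P) := by
  rw [coe_toRees, aeval_def, eval₂_eq', eval_eq', map_sum]
  refine Finset.sum_congr rfl fun m hm => ?_
  have hdeg : ∑ j, m j = b := sum_eq_of_mem_support hP hm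
  simp only [Polynomial.algebraMap_eq, ← Polynomial.C_mul_X_pow_eq_monomial, mul_pow,
    Finset.prod_mul_distrib, Finset.prod_pow_eq_pow_sum, pow_one, hdeg, map_mul, map_prod, map_pow,
    mul_assoc]

theorem toRees_surjective {k : Type*} [Field k] {r : ℕ}
    (F : Fin (r + 1) → MvPolynomial (Fin (r + 1)) k) : Function.Surjective (toRees F) := by
  intro x
  have h1 : ∀ n, ∃ P : MvPolynomial (Fin (r + 1)) (MvPolynomial (Fin (r + 1)) k),
      P.IsHomogeneous n ∧ eval F P = x.1.coeff n := fun n =>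
    (Ideal.mem_span_pow_iff_exists_isHomogeneous F _).1 (x.2 n)
  choose P hP hPx using h1
  refine ⟨∑ n ∈ x.1.support, P n, Subtype.ext ?_⟩
  rw [map_sum, AddSubmonoidClass.coe_finsetSum]
  conv_rhs => rw [x.1.as_sum_support]
  exact Finset.sum_congr rfl fun n _ => by rw [coe_toRees_of_isHomogeneous F (hP n), hPx]

/-- A form of degree `a + b d` in `I ^ b` is the value at `F` of a bihomogeneous polynomial: take a
form of degree `b` in `y` with this value, and keep the components of degree `a` of its
coefficients. -/
theorem exists_mem_bihomogeneous_eval_eq {k : Type*} [Field k] {r a b d : ℕ}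
    {F : Fin (r + 1) → MvPolynomial (Fin (r + 1)) k} (hF : ∀ i, (F i).IsHomogeneous d)
    {g : MvPolynomial (Fin (r + 1)) k} (hg : g.IsHomogeneous (a + b * d))
    (hgI : g ∈ baseIdeal F ^ b) : ∃ P ∈ bihomogeneous k r a b, eval F P = g := by
  classical
  obtain ⟨P, hP, rfl⟩ := (Ideal.mem_span_pow_iff_exists_isHomogeneous F _).1 hgI
  let Q : MvPolynomial (Fin (r + 1)) (MvPolynomial (Fin (r + 1)) k) :=
    ∑ m ∈ P.support, monomial m (homogeneousComponent a (P.coeff m))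
  have hQ : ∀ m, Q.coeff m = homogeneousComponent a (P.coeff m) := by
    intro m
    simp only [Q, coeff_sum, coeff_monomial, Finset.sum_ite_eq']
    split_ifs with hm
    · rfl
    · rw [notMem_support_iff.1 hm, map_zero]
  refine ⟨Q, ⟨fun m hm => hP fun h0 => hm (by rw [hQ, h0, map_zero]), fun m => ?_⟩, ?_⟩
  · rw [hQ]
    exact homogeneousComponent_isHomogeneous _ _
  · rw [← homogeneousComponent_eq_self hg]
    simp only [Q, map_sum, eval_monomial]
    conv_rhs => rw [eval_eq', map_sum]
    refine Finset.sum_congr rfl fun m hm => ?_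
    have hdeg : ∑ j, m j = b := sum_eq_of_mem_support hP hm
    have h2 : (∏ i, F i ^ m i).IsHomogeneous (b * d) := by
      rw [← hdeg, Finset.sum_mul]
      exact IsHomogeneous.prod _ _ _ fun i _ => mul_comm d (m i) ▸ (hF i).pow (m i)
    rw [homogeneousComponent_mul_of_isHomogeneous _ a h2, Finsupp.prod_fintype _ _ (by simp)]

theorem isHomogeneous_eval_of_mem_bihomogeneous {k : Type*} [Field k] {r a b d : ℕ}
    {F : Fin (r + 1) → MvPolynomial (Fin (r + 1)) k} (hF : ∀ i, (F i).IsHomogeneous d)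
    {P : MvPolynomial (Fin (r + 1)) (MvPolynomial (Fin (r + 1)) k)}
    (hP : P ∈ bihomogeneous k r a b) : (eval F P).IsHomogeneous (a + b * d) := by
  rw [eval_eq']
  refine IsHomogeneous.sum _ _ _ fun m hm => (hP.2 m).mul ?_
  have hdeg : ∑ j, m j = b := sum_eq_of_mem_support hP.1 hm
  rw [← hdeg, Finset.sum_mul]
  exact IsHomogeneous.prod _ _ _ fun i _ => mul_comm d (m i) ▸ (hF i).pow (m i)

theorem map_incidencePiece {k : Type*} [Field k] {r d p : ℕ}
    {F : Fin (r + 1) → MvPolynomial (Fin (r + 1)) k} (hF : ∀ i, (F i).IsHomogeneous d)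
    {φ : Matrix (Fin (r + 1)) (Fin p) (MvPolynomial (Fin (r + 1)) k)} {deg : Fin p → ℕ}
    (h : IsGradedPresentation F φ deg) (a b : ℕ) :
    (incidencePiece (linearPart φ deg) a b).map
        ((incidenceToRees h).toLinearMap.restrictScalars k) =
      reesPiece (baseIdeal F) d a b := by
  ext x
  constructor
  · rintro ⟨_, ⟨P, hP, rfl⟩, rfl⟩
    exact ⟨eval F P, isHomogeneous_eval_of_mem_bihomogeneous hF hP,
      (coe_toRees_of_isHomogeneous F hP.1).symm⟩
  · rintro ⟨g, hg, hgx⟩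
    have hgx' : Polynomial.monomial b g = x.1 := hgx
    have hgI : g ∈ baseIdeal F ^ b := by
      rw [← reesAlgebra.monomial_mem, hgx']
      exact x.2
    obtain ⟨P, hP, rfl⟩ := exists_mem_bihomogeneous_eval_eq hF hg hgI
    exact ⟨_, ⟨P, hP, rfl⟩, Subtype.ext ((coe_toRees_of_isHomogeneous F hP.1).trans hgx')⟩

/-! ### Row relations of the linear part -/

/-- If `M` has rank `r`, then any two row relations of `M` are proportional: otherwise they form a
`2 × (r + 1)` matrix of rank two whose kernel, of rank `r - 1`, contains the columns of `M`. -/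
theorem sameRationalMap_of_rank_eq {k : Type*} [Field k] {r : ℕ} {ι : Type*} [Fintype ι]
    {F w : Fin (r + 1) → MvPolynomial (Fin (r + 1)) k}
    {M : Matrix (Fin (r + 1)) ι (MvPolynomial (Fin (r + 1)) k)} (hrank : M.rank = r)
    (hF : F ᵥ* M = 0) (hw : w ᵥ* M = 0) : SameRationalMap w F := by
  intro i j
  by_contra hne
  let N : Matrix (Fin 2) (Fin (r + 1)) (MvPolynomial (Fin (r + 1)) k) := ![w, F]
  have hN : 2 ≤ N.rank := by
    have h1 : (N.submatrix id ![i, j]).rank = Fintype.card (Fin 2) :=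
      Matrix.rank_of_det_ne_zero fun h0 => by
        rw [Matrix.det_fin_two] at h0
        have h0' : w i * F j - w j * F i = 0 := h0
        exact hne (by linear_combination h0')
    exact (h1.symm.le : 2 ≤ _).trans (Matrix.rank_submatrix_le N id ![i, j])
  have hle : LinearMap.range M.mulVecLin ≤ LinearMap.ker N.mulVecLin := by
    rintro _ ⟨v, rfl⟩
    have hNM : N * M = 0 := by
      ext1 a b
      fin_cases a
      · exact congrFun hw b
      · exact congrFun hF b
    rw [LinearMap.mem_ker, Matrix.mulVecLin_apply, Matrix.mulVecLin_apply, Matrix.mulVec_mulVec,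
      hNM, Matrix.zero_mulVec]
  have h1 := (LinearMap.ker N.mulVecLin).finrank_quotient_add_finrank
  rw [N.mulVecLin.quotKerEquivRange.finrank_eq, Module.finrank_fintype_fun_eq_card,
    Fintype.card_fin] at h1
  have h2 := Submodule.finrank_mono hle
  unfold Matrix.rank at hN hrank
  omega

/-- If `ker ρ` is a minimal prime, then every row relation `w` of `φ₁` is proportional to `F`. The
kernel of `y_i ↦ F_i t + w_i s` is a prime contained in `ker ρ`, hence equal to it, so it contains
the elements `F_j y_i - F_i y_j`; the coefficient of `s` in their images vanishes. -/
theorem sameRationalMap_of_ker_mem_minimalPrimes {k : Type*} [Field k] {r p : ℕ}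
    {F w : Fin (r + 1) → MvPolynomial (Fin (r + 1)) k}
    {φ : Matrix (Fin (r + 1)) (Fin p) (MvPolynomial (Fin (r + 1)) k)} {deg : Fin p → ℕ}
    (h : IsGradedPresentation F φ deg)
    (hmin : RingHom.ker (incidenceToRees h) ∈ minimalPrimes (IncidenceAlgebra (linearPart φ deg)))
    (hw : w ᵥ* linearPart φ deg = 0) : SameRationalMap w F := by
  -- the inner polynomial variable is `t`, the outer one is `s`
  let Y : Fin (r + 1) → Polynomial (Polynomial (MvPolynomial (Fin (r + 1)) k)) := fun i =>
    Polynomial.C (Polynomial.monomial 1 (F i)) + Polynomial.monomial 1 (Polynomial.C (w i))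
  let Θ : MvPolynomial (Fin (r + 1)) (MvPolynomial (Fin (r + 1)) k) →ₐ[MvPolynomial (Fin (r + 1)) k]
    Polynomial (Polynomial (MvPolynomial (Fin (r + 1)) k)) := aeval Y
  have hΘ : ∀ P ∈ incidenceIdeal (linearPart φ deg), Θ P = 0 := by
    suffices incidenceIdeal (linearPart φ deg) ≤ RingHom.ker Θ from fun P hP => this hP
    refine Ideal.span_le.2 ?_
    rintro _ ⟨j, rfl⟩
    have hFj : ∑ i, F i * linearPart φ deg i j = 0 := congrFun h.vecMul_linearPart j
    have hwj : ∑ i, w i * linearPart φ deg i j = 0 := congrFun hw j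
    change Θ (∑ i, X i * C (linearPart φ deg i j)) = 0
    have h1 : ∀ i, Θ (X i * C (linearPart φ deg i j)) =
        Polynomial.C (Polynomial.monomial 1 (F i * linearPart φ deg i j)) +
          Polynomial.monomial 1 (Polynomial.C (w i * linearPart φ deg i j)) := by
      intro i
      rw [map_mul, aeval_X, aeval_C]
      change (_ + _) * Polynomial.C (Polynomial.C _) = _
      rw [add_mul, ← map_mul, Polynomial.monomial_mul_C, Polynomial.monomial_mul_C, ← map_mul]
    rw [map_sum, Finset.sum_congr rfl fun i _ => h1 i, Finset.sum_add_distrib, ← map_sum,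
      ← map_sum, ← map_sum, ← map_sum, hFj, hwj]
    simp
  let Θ' := Ideal.Quotient.liftₐ _ Θ hΘ
  have hker : RingHom.ker Θ' ≤ RingHom.ker (incidenceToRees h) := by
    intro x hx
    obtain ⟨P, rfl⟩ := Ideal.Quotient.mk_surjective x
    have hP : Θ P = 0 := hx
    change toRees F P = 0
    apply Subtype.ext
    rw [coe_toRees]
    -- setting `s = 0` in `Θ` gives back the map to the Rees algebra
    have h2 : (aeval (fun i => Polynomial.monomial 1 (F i)) :
        _ →ₐ[MvPolynomial (Fin (r + 1)) k] _) =
        ((Polynomial.aeval (0 : Polynomial (MvPolynomial (Fin (r + 1)) k))).restrictScalars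
          (MvPolynomial (Fin (r + 1)) k)).comp Θ := by
      ext i : 1
      simp [Θ, Y]
    rw [h2, AlgHom.comp_apply, hP, map_zero]
    rfl
  have hle := hmin.2 ⟨RingHom.ker_isPrime Θ', bot_le⟩ hker
  intro i j
  have hmem : Ideal.Quotient.mk (incidenceIdeal (linearPart φ deg))
      (C (F j) * X i - C (F i) * X j) ∈ RingHom.ker (incidenceToRees h) := by
    change toRees F _ = 0
    apply Subtype.ext
    rw [coe_toRees]
    simp [Polynomial.C_mul_monomial, mul_comm]
  have h3 : Θ (C (F j) * X i - C (F i) * X j) = 0 := hle hmem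
  have h4 : F j * w i - F i * w j = 0 := by
    simpa [Θ, Y] using congrArg (fun q => (Polynomial.coeff q 1).coeff 0) h3
  linear_combination h4

end PolyMap

theorem mainTheorem8 {k : Type*} [Field k] [IsAlgClosed k] [CharZero k] {r d p : ℕ}
    (F : Fin (r + 1) → MvPolynomial (Fin (r + 1)) k)
    (hF : ∀ i, (F i).IsHomogeneous d)
    (hcodim : 2 ≤ (PolyMap.baseIdeal F).height)
    (φ : Matrix (Fin (r + 1)) (Fin p) (MvPolynomial (Fin (r + 1)) k)) (deg : Fin p → ℕ)
    (hφ : PolyMap.IsGradedPresentation F φ deg) :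
    (Function.Surjective (PolyMap.incidenceToRees hφ) ∧
      ∀ a b : ℕ,
        (PolyMap.incidencePiece (PolyMap.linearPart φ deg) a b).map
            ((PolyMap.incidenceToRees hφ).toLinearMap.restrictScalars k) =
          PolyMap.reesPiece (PolyMap.baseIdeal F) d a b) ∧
    ((PolyMap.jacobian F).det ≠ 0 →
      RingHom.ker (PolyMap.incidenceToRees hφ) ∈
          minimalPrimes (PolyMap.IncidenceAlgebra (PolyMap.linearPart φ deg)) →
      PolyMap.IsCremona F) ∧
    ((PolyMap.jacobian F).det ≠ 0 →
      (PolyMap.linearPart φ deg).rank = r →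
      PolyMap.IsCremona F) := by
  have hM : ∀ i j, (PolyMap.linearPart φ deg i j).IsHomogeneous 1 := fun i j => by
    have h := hφ.isHomogeneous i j.1
    rwa [j.2] at h
  refine ⟨⟨fun x => ?_, PolyMap.map_incidencePiece hF hφ⟩, fun hJ hmin => ?_, fun hJ hrank => ?_⟩
  · obtain ⟨P, hP⟩ := PolyMap.toRees_surjective F x
    exact ⟨Ideal.Quotient.mk _ P, hP⟩
  · exact PolyMap.isCremona_of_vecMul_eq_zero hF hJ hM hφ.vecMul_linearPart fun w hw =>
      PolyMap.sameRationalMap_of_ker_mem_minimalPrimes hφ hmin hw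
  · exact PolyMap.isCremona_of_vecMul_eq_zero hF hJ hM hφ.vecMul_linearPart fun w hw =>
      PolyMap.sameRationalMap_of_rank_eq hrank hφ.vecMul_linearPart hw
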